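/- Let \(d\ge 0\), let \(L>0\), let \(f\colon\mathbb{R}^d\to\mathbb{R}\) be convex and \(L\)-smooth (differentiable with \(L\)-Lipschitz gradient), let \(h\colon\mathbb{R}^d\to\mathbb{R}\cup\{\infty\}\) be closed (lower semicontinuous), convex and proper, and assume that \(f+h\) has a minimizer \(x_\star\). For an integer \(N>0\) put \(\theta_0=1\), \(\theta_i=\tfrac12\bigl(1+\sqrt{1+4\theta_{i-1}^2}\bigr)\) for \(1\le i\le N-1\), \(\theta_N=\tfrac12\bigl(1+\sqrt{1+8\theta_{N-1}^2}\bigr)\), and \[ \gamma_i=\frac{2\theta_i}{\theta_N^2}\bigl(\theta_N^2-2\theta_i^2+\theta_i\bigr)\qquad(0\le i\le N-1). \] Let OptISTA be the method that, from an arbitrary starting point \(x_0=y_0=z_0\in\mathbb{R}^d\), computes for \(i=0,\dots,N-1\) \[ y_{i+1}=\mathrm{prox}_{\frac{\gamma_i}{L}h}\Bigl(y_i-\frac{\gamma_i}{L}\nabla f(x_i)\Bigr),\qquad z_{i+1}=x_i+\frac1{\gamma_i}(y_{i+1}-y_i), \] \[ x_{i+1}=z_{i+1}+\frac{\theta_i-1}{\theta_{i+1}}(z_{i+1}-z_i)+\frac{\theta_i}{\theta_{i+1}}(z_{i+1}-x_i),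 \] where \(\mathrm{prox}_{ch}(v)=\operatorname{argmin}_{u\in\mathbb{R}^d}\bigl\{h(u)+\tfrac1{2c}\|u-v\|^2\bigr\}\) for \(c>0\). Then all \(\gamma_i\) are positive, the iterates exist, and \[ f(y_N)+h(y_N)-f(x_\star)-h(x_\star)\le\frac{L\|x_0-x_\star\|^2}{2(\theta_N^2-1)}\le\frac{L\|x_0-x_\star\|^2}{(N+1)^2}. \] This bound is asymptotically smaller by a factor of \(2\) than the classical FISTA bound \(L\|x_0-x_\star\|^2/(2t_{N-1}^2)\), where \(t_0=1\) and \(t_{i+1}=\tfrac12\bigl(1+\sqrt{1+4t_i^2}\bigr)\): for every \(R>0\), \[ \lim_{N\to\infty}\ \frac{LR^2/(2t_{N-1}^2)}{LR^2/(2(\theta_N^2-1))}=2 . \] -/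

import Mathlib

noncomputable section

namespace OptISTA

/-- `f : ℝᵈ → ℝ` is convex and `L`-smooth: differentiable with an `L`-Lipschitz gradient. -/
structure IsSmoothConvex {d : ℕ} (L : ℝ) (f : EuclideanSpace ℝ (Fin d) → ℝ) : Prop where
  convex : ConvexOn ℝ Set.univ f
  differentiable : Differentiable ℝ f
  lipschitz_gradient : ∀ x y, ‖gradient f x - gradient f y‖ ≤ L * ‖x - y‖

/-- `h : ℝᵈ → ℝ ∪ {∞}` is closed (lower semicontinuous), convex and proper.  The values are
extended reals, and `⊥` is excluded by `ne_bot`. -/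
structure IsClosedConvexProper {d : ℕ} (h : EuclideanSpace ℝ (Fin d) → EReal) : Prop where
  ne_bot : ∀ x, h x ≠ ⊥
  exists_ne_top : ∃ x, h x ≠ ⊤
  convex : ∀ x y : EuclideanSpace ℝ (Fin d), ∀ a : ℝ, 0 < a → a < 1 →
    h (a • x + (1 - a) • y) ≤ (a : EReal) * h x + ((1 - a : ℝ) : EReal) * h y
  closed : LowerSemicontinuous h

/-- `x ∈ argmin (f + h)`. -/
def IsMinimizer {d : ℕ} (f : EuclideanSpace ℝ (Fin d) → ℝ)
    (h : EuclideanSpace ℝ (Fin d) → EReal) (x : EuclideanSpace ℝ (Fin d)) : Prop :=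
  ∀ u, (f x : EReal) + h x ≤ (f u : EReal) + h u

/-- `p = prox_{c h}(v)`, that is, `p` minimizes `u ↦ h u + ‖u - v‖² / (2 c)`
(used with `0 < c`). -/
def IsProx {d : ℕ} (c : ℝ) (h : EuclideanSpace ℝ (Fin d) → EReal)
    (v p : EuclideanSpace ℝ (Fin d)) : Prop :=
  ∀ u, h p + ((1 / (2 * c) * ‖p - v‖ ^ 2 : ℝ) : EReal)
    ≤ h u + ((1 / (2 * c) * ‖u - v‖ ^ 2 : ℝ) : EReal)

/-- The coefficients `θ₀, …, θ_N` for the iteration count `N`; the last one, `θ_N`, follows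
a modified recursion.  (Indices larger than `N` are never used.) -/
def theta (N : ℕ) : ℕ → ℝ
  | 0 => 1
  | i + 1 =>
    if i + 1 < N then (1 + √(1 + 4 * theta N i ^ 2)) / 2
    else (1 + √(1 + 8 * theta N i ^ 2)) / 2

/-- The stepsizes `γ₀, …, γ_{N-1}`. -/
def gamma (N i : ℕ) : ℝ :=
  2 * theta N i / theta N N ^ 2 * (theta N N ^ 2 - 2 * theta N i ^ 2 + theta N i)

/-- `x₀, …, x_N`, `y₀, …, y_N`, `z₀, …, z_N` are the iterates of OptISTA with iteration count
`N` started at `x₀`.  (Sequence entries with index larger than `N` are irrelevant.) -/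
structure IsRun {d : ℕ} (L : ℝ) (f : EuclideanSpace ℝ (Fin d) → ℝ)
    (h : EuclideanSpace ℝ (Fin d) → EReal) (N : ℕ) (x₀ : EuclideanSpace ℝ (Fin d))
    (x y z : ℕ → EuclideanSpace ℝ (Fin d)) : Prop where
  x_zero : x 0 = x₀
  y_zero : y 0 = x₀
  z_zero : z 0 = x₀
  y_succ : ∀ i < N, IsProx (gamma N i / L) h (y i - (gamma N i / L) • gradient f (x i)) (y (i + 1))
  z_succ : ∀ i < N, z (i + 1) = x i + (1 / gamma N i) • (y (i + 1) - y i)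
  x_succ : ∀ i < N, x (i + 1) = z (i + 1)
    + ((theta N i - 1) / theta N (i + 1)) • (z (i + 1) - z i)
    + (theta N i / theta N (i + 1)) • (z (i + 1) - x i)

/-- The upper bound for OptISTA after `N` iterations, where `R = ‖x₀ - x⋆‖`. -/
def rate (L R : ℝ) (N : ℕ) : ℝ := L * R ^ 2 / (2 * (theta N N ^ 2 - 1))

/-- The coefficients of FISTA (not depending on the iteration count). -/
def fistaTheta : ℕ → ℝ
  | 0 => 1
  | i + 1 => (1 + √(1 + 4 * fistaTheta i ^ 2)) / 2

/-- The classical upper bound for FISTA after `N ≥ 1` iterations, where `R = ‖x₀ - x⋆‖`. -/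
def fistaRate (L R : ℝ) (N : ℕ) : ℝ := L * R ^ 2 / (2 * fistaTheta (N - 1) ^ 2)

end OptISTA

end

/-!
The worst case is controlled by one nonnegative combination of inequalities between the iterates.
After moving `⟪∇f(x⋆), ·⟫` from `f` to `h` and dividing by `L`, the minimizer minimizes both parts
(`IsNormalizedRun`).  Write `φ_k` for the gradient of the smooth part at `x_k`, `σ_k` for the
subgradient of the nonsmooth part at `y_{k+1}` which the proximal step provides, and
`g_k = φ_k + σ_k`.

With `w_k = x_0 - ∑_{i<k} 2 θ_i g_i`, both `θ_N² (y_k - w_k)` and `2 θ_k² (x_k - w_k)` perform the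
same recursion, and therefore `x_N = y_N` (`x_last_eq_y_last`): the extrapolated iterates, at which
`f` is controlled, and the proximal iterates, at which `h` is controlled, meet at the end.

For the smooth part, the certificate is that of the optimized gradient method (the interpolation
inequality for consecutive iterates with weight `2 θ_k²`, and for the minimizer and each iterate
with weight `2 θ_k`, or `θ_N` for the last one), scaled by `ρ = (θ_N² - 1) / θ_N²`.  For the
nonsmooth part, the subgradient inequalities at `y_{k+1}` against the minimizer and all earlier
`y_{j+1}` combine, with the weights of `cumWeight`, into one inequality that involves only the point
`x_0 - ρ ∑_{i≤k} 2 θ_i g_i` (`subgradient_step`), and the inequality at `y_{k+1}` against `y_{k+2}`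
cancels the remaining products `⟪φ_{k+1}, σ_k⟫`.  Summing (`potential_le`), the mixed terms
telescope to `⟪∑ 2 θ_i φ_i, ∑ 2 θ_i σ_i⟫`.  What is left is a square, and a quadratic form in the
`σ_k` which is nonnegative by Jensen's inequality with weights that add up to `θ_N² - 1`
(`subgradEnergy_ge`, `norm_sq_weighted_subgradients_le`); see `normalized_rate`.

The proximal steps exist because `-∇f(x⋆)` is a subgradient of `h` at `x⋆`, which makes their
objectives coercive.  The explicit rate and the comparison with FISTA follow from
`θ_N² - θ_N = 2 t_{N-1}²` and the linear growth of `t`.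
-/

noncomputable section

namespace OptISTA

open Finset Filter Topology

/-! ### The coefficients -/

lemma sq_sub_self_of_eq_sqrt {a b t : ℝ} (hb : 0 ≤ b) (ht : t = (1 + √(1 + 4 * b * a ^ 2)) / 2) :
    t ^ 2 - t = b * a ^ 2 := by
  have h : √(1 + 4 * b * a ^ 2) ^ 2 = 1 + 4 * b * a ^ 2 := Real.sq_sqrt (by positivity)
  rw [ht]
  linear_combination h / 4

lemma theta_zero (N : ℕ) : theta N 0 = 1 := rfl

lemma theta_succ_sq {N i : ℕ} (hi : i + 1 < N) :
    theta N (i + 1) ^ 2 - theta N (i + 1) = theta N i ^ 2 := by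
  have h := sq_sub_self_of_eq_sqrt (a := theta N i) (b := 1) (t := theta N (i + 1)) one_pos.le
    (by rw [theta, if_pos hi, mul_one])
  rwa [one_mul] at h

lemma theta_last_sq (n : ℕ) :
    theta (n + 1) (n + 1) ^ 2 - theta (n + 1) (n + 1) = 2 * theta (n + 1) n ^ 2 :=
  sq_sub_self_of_eq_sqrt two_pos.le (by rw [theta, if_neg (lt_irrefl _)]; norm_num)

lemma one_le_theta (N i : ℕ) : 1 ≤ theta N i := by
  cases i with
  | zero => exact le_rfl
  | succ i =>
    rw [theta]
    split_ifs
    · have : 1 ≤ √(1 + 4 * theta N i ^ 2) :=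
        Real.one_le_sqrt.2 (by linarith [sq_nonneg (theta N i)])
      linarith
    · have : 1 ≤ √(1 + 8 * theta N i ^ 2) :=
        Real.one_le_sqrt.2 (by linarith [sq_nonneg (theta N i)])
      linarith

lemma theta_pos (N i : ℕ) : 0 < theta N i := one_pos.trans_le (one_le_theta N i)

lemma theta_le_theta {n i : ℕ} (hi : i ≤ n) : theta (n + 1) i ≤ theta (n + 1) n := by
  induction hi using Nat.decreasingInduction with
  | self => exact le_rfl
  | of_succ k hk ih =>
    refine le_trans ?_ ih
    have h := theta_succ_sq (N := n + 1) (i := k) (by omega)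
    nlinarith [theta_pos (n + 1) k, theta_pos (n + 1) (k + 1)]

lemma theta_eq_fistaTheta {n i : ℕ} (hi : i ≤ n) : theta (n + 1) i = fistaTheta i := by
  induction i with
  | zero => rfl
  | succ i ih => rw [theta, if_pos (by omega), fistaTheta, ih (by omega)]

lemma add_two_div_two_le_fistaTheta (i : ℕ) : ((i : ℝ) + 2) / 2 ≤ fistaTheta i := by
  induction i with
  | zero => simp [fistaTheta]
  | succ i ih =>
    have h0 : (0 : ℝ) ≤ i := i.cast_nonneg
    have h : 2 * fistaTheta i ≤ √(1 + 4 * fistaTheta i ^ 2) :=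
      Real.le_sqrt_of_sq_le (by linarith)
    rw [fistaTheta]
    push_cast
    linarith

/-- The denominator `θ_N² - 2 θ_k² + θ_k` of the partial sums of the weights that the certificate
puts on the subgradient inequalities of `h`; it is also the nontrivial factor of `γ_k`. -/
def slack (N k : ℕ) : ℝ := theta N N ^ 2 - 2 * theta N k ^ 2 + theta N k

lemma slack_pos {n k : ℕ} (hk : k ≤ n) : 0 < slack (n + 1) k := by
  have h1 := theta_last_sq n
  have h2 := theta_le_theta hk
  have h3 := theta_pos (n + 1) k
  have h4 := theta_pos (n + 1) (n + 1)
  rw [slack]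
  nlinarith

lemma slack_succ_le {n k : ℕ} (hk : k < n) : slack (n + 1) (k + 1) ≤ slack (n + 1) k := by
  have h1 := theta_succ_sq (N := n + 1) (i := k) (by omega)
  have h3 := theta_pos (n + 1) k
  have h4 := one_le_theta (n + 1) (k + 1)
  rw [slack, slack]
  nlinarith

lemma gamma_eq (N k : ℕ) : gamma N k = 2 * theta N k / theta N N ^ 2 * slack N k := rfl

lemma theta_sq_mul_gamma {N : ℕ} (k : ℕ) :
    theta N N ^ 2 * gamma N k = 2 * theta N k * slack N k := by
  have := theta_pos N N
  rw [gamma_eq]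
  field_simp

lemma gamma_pos {n k : ℕ} (hk : k ≤ n) : 0 < gamma (n + 1) k := by
  have := slack_pos hk
  have := theta_pos (n + 1) k
  have := theta_pos (n + 1) (n + 1)
  rw [gamma_eq]
  positivity

lemma sum_two_mul_theta {n k : ℕ} (hk : k ≤ n) :
    ∑ i ∈ range (k + 1), 2 * theta (n + 1) i = 2 * theta (n + 1) k ^ 2 := by
  induction k with
  | zero => simp [theta_zero]
  | succ k ih =>
    rw [sum_range_succ, ih (by omega), ← theta_succ_sq (N := n + 1) (i := k) (by omega)]
    ring

lemma sq_le_theta_last_sq (n : ℕ) :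
    ((n : ℝ) + 2) ^ 2 / 2 ≤ theta (n + 1) (n + 1) ^ 2 - 1 := by
  have h1 := theta_last_sq n
  have h2 := add_two_div_two_le_fistaTheta n
  rw [← theta_eq_fistaTheta le_rfl] at h2
  have h3 := one_le_theta (n + 1) (n + 1)
  have h0 : (0 : ℝ) ≤ n := n.cast_nonneg
  nlinarith

lemma theta_last_sq_sub_one_pos (n : ℕ) : 0 < theta (n + 1) (n + 1) ^ 2 - 1 :=
  lt_of_lt_of_le (by positivity) (sq_le_theta_last_sq n)

lemma rate_le {L : ℝ} (hL : 0 < L) (R : ℝ) (n : ℕ) :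
    rate L R (n + 1) ≤ L * R ^ 2 / (((n + 1 : ℕ) : ℝ) + 1) ^ 2 := by
  rw [rate]
  gcongr
  have := sq_le_theta_last_sq n
  push_cast
  linarith

/-- The ratio of the bounds is `(θ_N² - 1) / t_{N-1}²` with `θ_N² - θ_N = 2 t_{N-1}²`. -/
lemma fistaRate_div_rate {L R : ℝ} (hL : 0 < L) (hR : 0 < R) (n : ℕ) :
    fistaRate L R (n + 1) / rate L R (n + 1)
      = 2 + (theta (n + 1) (n + 1) - 1) / fistaTheta n ^ 2 := by
  have h1 := theta_last_sq n
  have h2 := theta_last_sq_sub_one_pos n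
  have h3 := theta_pos (n + 1) n
  rw [theta_eq_fistaTheta le_rfl] at h1 h3
  rw [fistaRate, rate, Nat.add_sub_cancel]
  field_simp
  linear_combination h1

lemma tendsto_fistaRate_div_rate {L R : ℝ} (hL : 0 < L) (hR : 0 < R) :
    Tendsto (fun N : ℕ => fistaRate L R N / rate L R N) atTop (𝓝 2) := by
  rw [← tendsto_add_atTop_iff_nat 1]
  simp_rw [fistaRate_div_rate hL hR]
  have hlim : Tendsto (fun n : ℕ => 2 / fistaTheta n) atTop (𝓝 0) := by
    refine Tendsto.const_div_atTop (tendsto_atTop_mono add_two_div_two_le_fistaTheta ?_) 2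
    exact (tendsto_natCast_atTop_atTop.atTop_add tendsto_const_nhds).atTop_div_const two_pos
  have : Tendsto (fun n : ℕ => (theta (n + 1) (n + 1) - 1) / fistaTheta n ^ 2) atTop (𝓝 0) := by
    refine squeeze_zero (fun n => ?_) (fun n => ?_) hlim
    · have := one_le_theta (n + 1) (n + 1)
      exact div_nonneg (by linarith) (sq_nonneg _)
    · have h1 := theta_last_sq n
      have h2 := one_le_theta (n + 1) n
      have h3 := one_le_theta (n + 1) (n + 1)
      rw [theta_eq_fistaTheta le_rfl] at h1 h2
      rw [div_le_div_iff₀ (by positivity) (by positivity)]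
      -- `(θ_N - 1)² ≤ θ_N² - θ_N = 2 t²`
      have h4 : theta (n + 1) (n + 1) - 1 ≤ 2 * fistaTheta n := by nlinarith
      nlinarith
  simpa using this.const_add 2

/-! ### Subgradients and smooth convex functions -/

section ConvexAnalysis

variable {E : Type*} [NormedAddCommGroup E] [InnerProductSpace ℝ E]

/-- A lower bound `t c` on the increments of `φ` along the segment from `p` in direction `v`
bounds the directional derivative. -/
lemma le_inner_of_hasGradientAt [CompleteSpace E] {φ : E → ℝ} {p g v : E} {c : ℝ}
    (hφ : HasGradientAt φ g p)
    (h : ∀ t : ℝ, 0 < t → t < 1 → t * c ≤ φ (p + t • v) - φ p) : c ≤ inner ℝ g v := by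
  have h1 : HasDerivAt (fun t : ℝ => φ (p + t • v)) (inner ℝ g v) 0 := by
    have h2 : HasDerivAt (fun t : ℝ => p + t • v) v 0 := by
      simpa using ((hasDerivAt_id (0 : ℝ)).smul_const v).const_add p
    have h3 : HasFDerivAt φ (InnerProductSpace.toDual ℝ E g) (p + (0 : ℝ) • v) := by
      simpa using hφ.hasFDerivAt
    have h4 := h3.comp_hasDerivAt (0 : ℝ) h2
    rwa [InnerProductSpace.toDual_apply_apply] at h4
  have h4 := h1.tendsto_slope_zero_right
  refine ge_of_tendsto h4 ?_
  filter_upwards [Ioo_mem_nhdsGT (zero_lt_one' ℝ)] with t ht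
  have h5 := h t ht.1 ht.2
  simp only [zero_add, zero_smul, add_zero, smul_eq_mul]
  rw [inv_mul_eq_div, le_div_iff₀ ht.1]
  linarith

lemma inner_gradient_le_of_convexOn [CompleteSpace E] {φ : E → ℝ} {p g : E}
    (hφ : HasGradientAt φ g p) (hc : ConvexOn ℝ Set.univ φ) (u : E) :
    φ p + inner ℝ g (u - p) ≤ φ u := by
  have h := le_inner_of_hasGradientAt (φ := fun x => - φ x) (g := -g) (v := u - p)
    (c := φ p - φ u) (p := p) ?_ ?_
  · rw [inner_neg_left] at h
    linarith
  · rw [hasGradientAt_iff_hasFDerivAt, map_neg]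
    exact hφ.hasFDerivAt.neg
  · intro t ht0 ht1
    have h := hc.2 (Set.mem_univ p) (Set.mem_univ u) (sub_nonneg.2 ht1.le) ht0.le (by ring)
    have e : (1 - t) • p + t • u = p + t • (u - p) := by module
    rw [e, smul_eq_mul, smul_eq_mul] at h
    linarith

end ConvexAnalysis

variable {d : ℕ} {L : ℝ} {f : EuclideanSpace ℝ (Fin d) → ℝ}
  {h : EuclideanSpace ℝ (Fin d) → EReal}

lemma IsSmoothConvex.descent (hf : IsSmoothConvex L f) (x y : EuclideanSpace ℝ (Fin d)) :
    f y ≤ f x + inner ℝ (gradient f x) (y - x) + L / 2 * ‖y - x‖ ^ 2 := by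
  set v := y - x with hv
  have hder : ∀ t : ℝ, HasDerivAt
      (fun t : ℝ => f (x + t • v) - t * inner ℝ (gradient f x) v - L / 2 * t ^ 2 * ‖v‖ ^ 2)
      (inner ℝ (gradient f (x + t • v)) v - inner ℝ (gradient f x) v - L * t * ‖v‖ ^ 2) t := by
    intro t
    have h2 : HasDerivAt (fun t : ℝ => x + t • v) v t := by
      simpa using ((hasDerivAt_id t).smul_const v).const_add x
    have h3 := (hf.differentiable (x + t • v)).hasGradientAt.hasFDerivAt
    have h4 : HasDerivAt (fun t : ℝ => f (x + t • v)) (inner ℝ (gradient f (x + t • v)) v) t := by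
      have h5 := h3.comp_hasDerivAt t h2
      rwa [InnerProductSpace.toDual_apply_apply] at h5
    have h5 := ((hasDerivAt_id t).mul_const (inner ℝ (gradient f x) v))
    have h6 := (((hasDerivAt_id t).pow 2).const_mul (L / 2)).mul_const (‖v‖ ^ 2)
    refine ((h4.sub h5).sub h6).congr_deriv ?_
    simp only [id, Nat.cast_ofNat, Nat.add_one_sub_one, pow_one]
    ring
  have hanti := antitoneOn_of_deriv_nonpos (convex_Icc (0 : ℝ) 1)
    (fun t _ => (hder t).continuousAt.continuousWithinAt)
    (fun t _ => (hder t).differentiableAt.differentiableWithinAt)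
    (fun t ht => by
      rw [interior_Icc] at ht
      rw [(hder t).deriv, ← inner_sub_left]
      have h1 := real_inner_le_norm (gradient f (x + t • v) - gradient f x) v
      have h2 := hf.lipschitz_gradient (x + t • v) x
      rw [add_sub_cancel_left, norm_smul, Real.norm_of_nonneg ht.1.le] at h2
      nlinarith [norm_nonneg v])
  have h01 := hanti (Set.left_mem_Icc.2 zero_le_one) (Set.right_mem_Icc.2 zero_le_one) zero_le_one
  simp only [one_smul, zero_smul, add_zero, hv, add_sub_cancel] at h01
  rw [hv]
  linarith

/-- The interpolation inequality of smooth convex functions: compare the descent inequality at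
`x - (∇f x - ∇f y) / L` with the gradient inequality at `y`. -/
lemma IsSmoothConvex.interpolation (hL : 0 < L) (hf : IsSmoothConvex L f)
    (x y : EuclideanSpace ℝ (Fin d)) :
    f y + inner ℝ (gradient f y) (x - y) + 1 / (2 * L) * ‖gradient f x - gradient f y‖ ^ 2
      ≤ f x := by
  set g := gradient f x - gradient f y with hg
  have h1 := hf.descent x (x - L⁻¹ • g)
  have h2 := inner_gradient_le_of_convexOn (hf.differentiable y).hasGradientAt hf.convex
    (x - L⁻¹ • g)
  have e1 : x - L⁻¹ • g - x = -(L⁻¹ • g) := by abel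
  have e2 : x - L⁻¹ • g - y = (x - y) - L⁻¹ • g := by abel
  rw [e1, norm_neg, norm_smul, inner_neg_right, inner_smul_right, Real.norm_of_nonneg
    (inv_nonneg.2 hL.le)] at h1
  rw [e2, inner_sub_right, inner_smul_right] at h2
  have h3 : inner ℝ (gradient f x) g - inner ℝ (gradient f y) g = ‖g‖ ^ 2 := by
    rw [← inner_sub_left, ← hg, real_inner_self_eq_norm_sq]
  have h4 : L / 2 * (L⁻¹ * ‖g‖) ^ 2 = L⁻¹ * ‖g‖ ^ 2 / 2 := by field_simp
  have h5 : 1 / (2 * L) * ‖g‖ ^ 2 = L⁻¹ * ‖g‖ ^ 2 / 2 := by field_simp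
  rw [h4] at h1
  rw [h5]
  have h6 : L⁻¹ * inner ℝ (gradient f x) g - L⁻¹ * inner ℝ (gradient f y) g = L⁻¹ * ‖g‖ ^ 2 := by
    rw [← h3]; ring
  linarith

/-! ### Minimizers of composite functions and the proximal step -/

lemma IsMinimizer.ne_top {φ : EuclideanSpace ℝ (Fin d) → ℝ} (hh : IsClosedConvexProper h)
    {p : EuclideanSpace ℝ (Fin d)} (hp : IsMinimizer φ h p) : h p ≠ ⊤ := by
  obtain ⟨u, hu⟩ := hh.exists_ne_top
  intro htop
  have h1 := hp u
  rw [htop, EReal.coe_add_top, top_le_iff] at h1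
  exact EReal.add_ne_top (EReal.coe_ne_top _) hu h1

/-- Fermat's rule: where `φ + h` is minimal, `-∇φ` is a subgradient of `h`. -/
lemma IsMinimizer.subgradient {φ : EuclideanSpace ℝ (Fin d) → ℝ} (hh : IsClosedConvexProper h)
    {p g : EuclideanSpace ℝ (Fin d)} (hp : IsMinimizer φ h p) (hφ : HasGradientAt φ g p)
    {u : EuclideanSpace ℝ (Fin d)} (hu : h u ≠ ⊤) :
    (h p).toReal - inner ℝ g (u - p) ≤ (h u).toReal := by
  have e1 := EReal.coe_toReal (hp.ne_top hh) (hh.ne_bot p)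
  have e2 := EReal.coe_toReal hu (hh.ne_bot u)
  have key := le_inner_of_hasGradientAt (v := u - p) (c := (h p).toReal - (h u).toReal) hφ ?_
  · linarith
  intro t ht0 ht1
  have h1 := hp (p + t • (u - p))
  have h2 := hh.convex u p t ht0 ht1
  have e : t • u + (1 - t) • p = p + t • (u - p) := by module
  rw [e] at h2
  have h3 := h1.trans (add_le_add_right h2 _)
  rw [← e1, ← e2] at h3
  have h4 : φ p + (h p).toReal
      ≤ φ (p + t • (u - p)) + (t * (h u).toReal + (1 - t) * (h p).toReal) := by exact_mod_cast h3
  linarith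

lemma IsProx.isMinimizer {c : ℝ} {v p : EuclideanSpace ℝ (Fin d)} (hp : IsProx c h v p) :
    IsMinimizer (fun u => 1 / (2 * c) * ‖u - v‖ ^ 2) h p := by
  intro u
  rw [add_comm, add_comm _ (h u)]
  exact hp u

lemma hasGradientAt_dist_sq (c : ℝ) (v p : EuclideanSpace ℝ (Fin d)) :
    HasGradientAt (fun u => 1 / (2 * c) * ‖u - v‖ ^ 2) (c⁻¹ • (p - v)) p := by
  rw [hasGradientAt_iff_hasFDerivAt]
  have h1 := (((hasFDerivAt_id p).sub_const v).norm_sq).const_mul (1 / (2 * c))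
  refine h1.congr_fderiv (ContinuousLinearMap.ext fun u => ?_)
  simp
  ring

lemma IsProx.subgradient {c : ℝ} (hh : IsClosedConvexProper h)
    {v p u : EuclideanSpace ℝ (Fin d)} (hp : IsProx c h v p) (hu : h u ≠ ⊤) :
    (h p).toReal + inner ℝ (c⁻¹ • (v - p)) (u - p) ≤ (h u).toReal := by
  have h1 := hp.isMinimizer.subgradient hh (hasGradientAt_dist_sq c v p) hu
  rw [← neg_sub v p, smul_neg, inner_neg_left] at h1
  linarith

/-- The proximal map exists as soon as `h` has one subgradient `g`: the objective is then
coercive, so that it attains its minimum on a large ball. -/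
lemma exists_isProx {c : ℝ} (hc : 0 < c) (hh : IsClosedConvexProper h)
    {p g : EuclideanSpace ℝ (Fin d)} (hp : h p ≠ ⊤)
    (hg : ∀ u, h u ≠ ⊤ → (h p).toReal + inner ℝ g (u - p) ≤ (h u).toReal)
    (v : EuclideanSpace ℝ (Fin d)) : ∃ q, IsProx c h v q := by
  have hlsc : LowerSemicontinuous
      fun u => h u + ((1 / (2 * c) * ‖u - v‖ ^ 2 : ℝ) : EReal) := by
    refine hh.closed.add' (Continuous.lowerSemicontinuous ?_) fun u => ?_
    · exact continuous_coe_real_ereal.comp (by fun_prop)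
    · exact EReal.continuousAt_add (Or.inr (EReal.coe_ne_bot _)) (Or.inr (EReal.coe_ne_top _))
  -- outside this ball, the objective exceeds its value at `p`
  set r := 2 * c * (‖g‖ + c⁻¹ * ‖p - v‖) with hr
  have hr0 : 0 ≤ r := by positivity
  obtain ⟨q, -, hq⟩ := (hlsc.lowerSemicontinuousOn (Metric.closedBall p r)).exists_isMinOn
    ⟨p, Metric.mem_closedBall_self hr0⟩ (isCompact_closedBall p r)
  refine ⟨q, fun u => ?_⟩
  by_cases hu : u ∈ Metric.closedBall p r
  · exact hq hu
  by_cases hutop : h u = ⊤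
  · rw [hutop, EReal.top_add_coe]
    exact le_top
  refine (hq (Metric.mem_closedBall_self hr0)).trans ?_
  rw [Metric.mem_closedBall, dist_eq_norm, not_le] at hu
  have h1 := hg u hutop
  dsimp only
  rw [← EReal.coe_toReal hp (hh.ne_bot p), ← EReal.coe_toReal hutop (hh.ne_bot u),
    ← EReal.coe_add, ← EReal.coe_add, EReal.coe_le_coe_iff]
  have h2 : ‖u - v‖ ^ 2 = ‖u - p‖ ^ 2 + 2 * inner ℝ (u - p) (p - v) + ‖p - v‖ ^ 2 := by
    rw [← norm_add_sq_real, sub_add_sub_cancel]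
  have h3 := abs_le.1 (abs_real_inner_le_norm (u - p) (p - v))
  have h4 := abs_le.1 (abs_real_inner_le_norm g (u - p))
  have h5 : 1 / (2 * c) * ‖u - p‖ ^ 2 ≥ (‖g‖ + c⁻¹ * ‖p - v‖) * ‖u - p‖ := by
    have : 1 / (2 * c) * ‖u - p‖ ≥ ‖g‖ + c⁻¹ * ‖p - v‖ := by
      rw [ge_iff_le, one_div_mul_eq_div, le_div_iff₀ (by positivity)]
      linarith
    nlinarith [norm_nonneg (u - p)]
  have h6 : 1 / (2 * c) * (2 * inner ℝ (u - p) (p - v)) ≥ - (c⁻¹ * ‖p - v‖ * ‖u - p‖) := by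
    have e : 1 / (2 * c) * (2 * inner ℝ (u - p) (p - v)) = c⁻¹ * inner ℝ (u - p) (p - v) := by
      field_simp
    have := mul_le_mul_of_nonneg_left h3.1 (inv_nonneg.2 hc.le)
    rw [e]
    linarith
  rw [h2]
  linarith [h4.1]

/-! ### Weights of the certificate -/

/-- The factor `ρ = (θ_N² - 1) / θ_N²`, with `N = n + 1`, by which the certificate of the smooth
part is scaled down in the presence of the nonsmooth part. -/
def ratio (n : ℕ) : ℝ := (theta (n + 1) (n + 1) ^ 2 - 1) / theta (n + 1) (n + 1) ^ 2

/-- The cumulative weights `c_k = (θ_N² - 1) / (θ_N² - 2 θ_k² + θ_k)`, with `N = n + 1`.  In the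
certificate, the subgradient inequality of `h` at `y_{l+1}` against an earlier point `y_{k+1}`
carries the weight `c_{k+1} - c_k`, relative to the one at `y_{l+1}` against the minimizer. -/
def cumWeight (n k : ℕ) : ℝ := (theta (n + 1) (n + 1) ^ 2 - 1) / slack (n + 1) k

lemma ratio_pos (n : ℕ) : 0 < ratio n :=
  div_pos (theta_last_sq_sub_one_pos n) (pow_pos (theta_pos _ _) 2)

lemma ratio_mul_theta_sq (n : ℕ) :
    ratio n * theta (n + 1) (n + 1) ^ 2 = theta (n + 1) (n + 1) ^ 2 - 1 :=
  div_mul_cancel₀ _ (pow_pos (theta_pos _ _) 2).ne'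

lemma cumWeight_zero (n : ℕ) : cumWeight n 0 = 1 := by
  rw [cumWeight, slack, theta_zero, div_eq_one_iff_eq]
  · ring
  · linarith [theta_last_sq_sub_one_pos n]

lemma cumWeight_mul_slack {n k : ℕ} (hk : k ≤ n) :
    cumWeight n k * slack (n + 1) k = theta (n + 1) (n + 1) ^ 2 - 1 :=
  div_mul_cancel₀ _ (slack_pos hk).ne'

lemma cumWeight_pos {n k : ℕ} (hk : k ≤ n) : 0 < cumWeight n k :=
  div_pos (theta_last_sq_sub_one_pos n) (slack_pos hk)

lemma cumWeight_le_succ {n k : ℕ} (hk : k < n) : cumWeight n k ≤ cumWeight n (k + 1) :=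
  div_le_div_of_nonneg_left (theta_last_sq_sub_one_pos n).le (slack_pos hk) (slack_succ_le hk)

lemma cumWeight_mul_gamma {n k : ℕ} (hk : k ≤ n) :
    cumWeight n k * gamma (n + 1) k = 2 * ratio n * theta (n + 1) k := by
  have := cumWeight_mul_slack hk
  have h1 := theta_pos (n + 1) (n + 1)
  rw [gamma_eq, ratio]
  field_simp
  linear_combination theta (n + 1) k * this

/-! ### The certificate -/

/-- The data of a run of `n + 1` iterations, after translating the minimizer to `0`, dividing both
functions by `L`, and moving the linear function `⟪∇f(x⋆), ·⟫` from `f` to `h`, so that `0`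
minimizes both parts.  `φ k` is the gradient of the smooth part at `x k`, and `σ k` the subgradient
of the nonsmooth part at `y (k + 1)`; `F k` and `η k` are the corresponding values, in excess of
those at `0`.  The fields are the recursions of the method and the inequalities between these data
that the certificate combines. -/
structure IsNormalizedRun {E : Type*} [NormedAddCommGroup E] [InnerProductSpace ℝ E]
    (n : ℕ) (x y φ σ : ℕ → E) (F η : ℕ → ℝ) : Prop where
  y_zero : y 0 = x 0
  y_succ : ∀ k ≤ n, y (k + 1) = y k - gamma (n + 1) k • (φ k + σ k)
  x_succ : ∀ k < n, theta (n + 1) (k + 1) ^ 2 • x (k + 1)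
    = theta (n + 1) k ^ 2 • (x k - (φ k + σ k))
      + theta (n + 1) (k + 1) • (x 0 - ∑ i ∈ range (k + 1), (2 * theta (n + 1) i) • (φ i + σ i))
  x_last : theta (n + 1) (n + 1) ^ 2 • x (n + 1)
    = (2 * theta (n + 1) n ^ 2) • (x n - (φ n + σ n))
      + theta (n + 1) (n + 1) • (x 0 - ∑ i ∈ range (n + 1), (2 * theta (n + 1) i) • (φ i + σ i))
  smooth_zero : ∀ k ≤ n + 1, F k + 1 / 2 * ‖φ k‖ ^ 2 ≤ inner ℝ (φ k) (x k)
  smooth_succ : ∀ k ≤ n,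
    F (k + 1) + inner ℝ (φ (k + 1)) (x k - x (k + 1)) + 1 / 2 * ‖φ k - φ (k + 1)‖ ^ 2 ≤ F k
  subgradient_zero : ∀ k ≤ n, η k ≤ inner ℝ (σ k) (y (k + 1))
  subgradient : ∀ k ≤ n, ∀ l ≤ n, η l - η k ≤ inner ℝ (σ l) (y (l + 1) - y (k + 1))

/-- The quadratic form in the subgradients `σ 0, …, σ k` that is left over besides the square of the
weighted sum of all `φ i + σ i`:
`∑_{i<k} 2 θ_i² ⟪σ_i, σ_i - σ_{i+1}⟫ + 2 θ_k² ‖σ_k‖²`. -/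
def subgradEnergy {E : Type*} [NormedAddCommGroup E] [InnerProductSpace ℝ E]
    (n : ℕ) (σ : ℕ → E) : ℕ → ℝ
  | 0 => 2 * ‖σ 0‖ ^ 2
  | k + 1 => subgradEnergy n σ k - 2 * theta (n + 1) k ^ 2 * inner ℝ (σ k) (σ (k + 1))
    + 2 * theta (n + 1) (k + 1) ^ 2 * ‖σ (k + 1)‖ ^ 2

namespace IsNormalizedRun

variable {E : Type*} [NormedAddCommGroup E] [InnerProductSpace ℝ E] {n : ℕ}
  {x y φ σ : ℕ → E} {F η : ℕ → ℝ}

/-- The invariant that ties the two sequences together.  It holds for `k ≤ n` only, since the last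
step uses a modified recursion. -/
lemma theta_sq_smul_sub (hr : IsNormalizedRun n x y φ σ F η) {k : ℕ} (hk : k ≤ n) :
    theta (n + 1) (n + 1) ^ 2
        • (y k - (x 0 - ∑ i ∈ range k, (2 * theta (n + 1) i) • (φ i + σ i)))
      = (2 * theta (n + 1) k ^ 2)
        • (x k - (x 0 - ∑ i ∈ range k, (2 * theta (n + 1) i) • (φ i + σ i))) := by
  induction k with
  | zero => simp [hr.y_zero]
  | succ k ih =>
    have h1 := ih (by omega)
    have h2 := hr.x_succ k hk
    have h3 := theta_succ_sq (N := n + 1) (i := k) (by omega)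
    have h4 := theta_sq_mul_gamma (N := n + 1) k
    rw [slack] at h4
    rw [hr.y_succ k (by omega)]
    rw [sum_range_succ] at h2 ⊢
    set S := ∑ i ∈ range k, (2 * theta (n + 1) i) • (φ i + σ i)
    set g := φ k + σ k
    linear_combination (norm := module) h1 - (2 : ℝ) • h2 - h4 • g
      + (2 : ℝ) • h3 • (x 0 - S - (2 * theta (n + 1) k) • g)

/-- The gradient steps and the extrapolated proximal steps end in the same point. -/
lemma x_last_eq_y_last (hr : IsNormalizedRun n x y φ σ F η) : x (n + 1) = y (n + 1) := by
  have h0 := theta_pos (n + 1) (n + 1)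
  refine smul_right_injective E (pow_pos h0 2).ne' ?_
  have h1 := hr.theta_sq_smul_sub le_rfl
  have h2 := hr.x_last
  have h3 := theta_last_sq n
  have h4 := theta_sq_mul_gamma (N := n + 1) n
  rw [slack] at h4
  simp only
  rw [hr.y_succ n le_rfl]
  rw [sum_range_succ] at h2
  set S := ∑ i ∈ range n, (2 * theta (n + 1) i) • (φ i + σ i)
  set g := φ n + σ n
  linear_combination (norm := module) h2 - h1 + h4 • g - h3 • (x 0 - S - (2 * theta (n + 1) n) • g)

/-- The points `c_k y_{k+1} - ∑_{j<k} (c_{j+1} - c_j) y_{j+1}` perform gradient steps with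
stepsizes `2 ρ θ_i`. -/
lemma cumWeight_smul_sub_sum (hr : IsNormalizedRun n x y φ σ F η) {k : ℕ} (hk : k ≤ n) :
    cumWeight n k • y (k + 1) - ∑ j ∈ range k, (cumWeight n (j + 1) - cumWeight n j) • y (j + 1)
      = x 0 - ratio n • ∑ i ∈ range (k + 1), (2 * theta (n + 1) i) • (φ i + σ i) := by
  induction k with
  | zero =>
    have h := cumWeight_mul_gamma (Nat.zero_le n)
    rw [cumWeight_zero, one_mul] at h
    simp only [cumWeight_zero, range_zero, sum_empty, zero_add, range_one, sum_singleton]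
    rw [hr.y_succ 0 (by omega), hr.y_zero, h]
    module
  | succ k ih =>
    have h1 := ih (by omega)
    have h2 := cumWeight_mul_gamma hk
    rw [sum_range_succ _ k, sum_range_succ _ (k + 1), hr.y_succ (k + 1) hk]
    linear_combination (norm := module) h1 - h2 • (φ (k + 1) + σ (k + 1))

lemma weighted_subgradient (hr : IsNormalizedRun n x y φ σ F η) {k l : ℕ} (hkl : k ≤ l)
    (hl : l ≤ n) :
    cumWeight n k * η l - ∑ j ∈ range k, (cumWeight n (j + 1) - cumWeight n j) * η j
      ≤ inner ℝ (σ l) (cumWeight n k • y (l + 1)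
        - ∑ j ∈ range k, (cumWeight n (j + 1) - cumWeight n j) • y (j + 1)) := by
  induction k with
  | zero => simpa [cumWeight_zero] using hr.subgradient_zero l hl
  | succ k ih =>
    have h1 := ih (by omega)
    have h2 := mul_le_mul_of_nonneg_left (hr.subgradient k (by omega) l hl)
      (sub_nonneg.2 (cumWeight_le_succ (show k < n by omega)))
    rw [sum_range_succ, sum_range_succ]
    simp only [inner_sub_right, inner_add_right, inner_smul_right] at h1 h2 ⊢
    linarith

/-- The combination of the subgradient inequalities at `y_{k+1}` in which the point at which the
subgradient is tested has become a gradient-descent iterate. -/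
lemma subgradient_step (hr : IsNormalizedRun n x y φ σ F η) {k : ℕ} (hk : k ≤ n) :
    cumWeight n k * η k - ∑ j ∈ range k, (cumWeight n (j + 1) - cumWeight n j) * η j
      ≤ inner ℝ (σ k)
        (x 0 - ratio n • ∑ i ∈ range (k + 1), (2 * theta (n + 1) i) • (φ i + σ i)) := by
  rw [← hr.cumWeight_smul_sub_sum hk]
  exact hr.weighted_subgradient le_rfl hk

/-- The inequality that bounds the value at `y_{k+1}` by the one at `y_{k+2}`; its inner product
with `φ (k + 1)` cancels the one that the smooth part leaves over. -/
lemma backward_subgradient (hr : IsNormalizedRun n x y φ σ F η) {k : ℕ} (hk : k < n) :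
    cumWeight n (k + 1) * (η k - η (k + 1))
      ≤ 2 * ratio n * theta (n + 1) (k + 1) * inner ℝ (σ k) (φ (k + 1) + σ (k + 1)) := by
  have h1 := mul_le_mul_of_nonneg_left (hr.subgradient (k + 1) hk k hk.le)
    (cumWeight_pos (show k + 1 ≤ n from hk)).le
  rw [hr.y_succ (k + 1) hk, sub_sub_cancel, inner_smul_right] at h1
  rw [← cumWeight_mul_gamma (show k + 1 ≤ n from hk)]
  linarith

/-- The combination of the first `k + 1` steps' inequalities.  The second summand on the left is
what remains of the values of the nonsmooth part, whose weights become `0` except for the last one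
when `k = n` and `θ_N - 1` times the inequality of `subgradient_step` is added. -/
lemma potential_le (hr : IsNormalizedRun n x y φ σ F η) {k : ℕ} (hk : k ≤ n) :
    2 * ratio n * theta (n + 1) k ^ 2 * (F k - 1 / 2 * ‖φ k‖ ^ 2)
      + (theta (n + 1) (n + 1) ^ 2 - 1 - 2 * theta (n + 1) k ^ 2)
        * (∑ j ∈ range k, (cumWeight n (j + 1) - cumWeight n j) * η j - cumWeight n k * η k)
      + (theta (n + 1) (n + 1) ^ 2 - 1) * η k
    ≤ inner ℝ (x 0) (ratio n • ∑ i ∈ range (k + 1), (2 * theta (n + 1) i) • φ i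
        + ∑ i ∈ range (k + 1), (2 * theta (n + 1) i) • σ i)
      - ratio n / 2 * ‖∑ i ∈ range (k + 1), (2 * theta (n + 1) i) • (φ i + σ i)‖ ^ 2
      - ratio n * subgradEnergy n σ k := by
  induction k with
  | zero =>
    have h1 := mul_le_mul_of_nonneg_left (hr.smooth_zero 0 (by omega)) (ratio_pos n).le
    have h2 := hr.subgradient_step (Nat.zero_le n)
    simp only [range_zero, sum_empty, zero_add, range_one, sum_singleton, theta_zero,
      cumWeight_zero, subgradEnergy, ← real_inner_self_eq_norm_sq, inner_add_left,
      inner_add_right, inner_sub_right, inner_smul_left, inner_smul_right,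
      RCLike.conj_to_real] at h1 h2 ⊢
    rw [real_inner_comm (x 0) (φ 0)] at h1
    rw [real_inner_comm (x 0) (σ 0)] at h2
    rw [real_inner_comm (σ 0) (φ 0)]
    linarith
  | succ k ih =>
    have h0 := ih (by omega)
    have hθ := theta_succ_sq (N := n + 1) (i := k) (by omega)
    have hpos := theta_pos (n + 1) (k + 1)
    have hρ := (ratio_pos n).le
    have hc := cumWeight_mul_slack hk
    have h1 := mul_le_mul_of_nonneg_left (hr.smooth_succ k (by omega))
      (show 0 ≤ 2 * ratio n * theta (n + 1) k ^ 2 by positivity)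
    have h2 := mul_le_mul_of_nonneg_left (hr.smooth_zero (k + 1) (by omega))
      (show 0 ≤ 2 * ratio n * theta (n + 1) (k + 1) by positivity)
    have h3 := mul_le_mul_of_nonneg_left (hr.subgradient_step hk)
      (show 0 ≤ 2 * theta (n + 1) (k + 1) by positivity)
    -- the multiplier is `θ_k² / θ_{k+1}`
    have h4 := mul_le_mul_of_nonneg_left (hr.backward_subgradient hk)
      (show 0 ≤ theta (n + 1) (k + 1) - 1 by linarith [one_le_theta (n + 1) (k + 1)])
    have hx := congrArg (fun v => 2 * ratio n * inner ℝ (φ (k + 1)) v) (hr.x_succ k hk)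
    have hη := sum_range_succ (fun j => (cumWeight n (j + 1) - cumWeight n j) * η j) k
    rw [slack] at hc
    simp only [subgradEnergy, sum_range_succ _ (k + 1), smul_add, sum_add_distrib] at h0 h3 hx ⊢
    rw [hη] at h3 ⊢
    generalize ∑ i ∈ range (k + 1), (2 * theta (n + 1) i) • φ i = G at h0 h3 hx ⊢
    generalize ∑ i ∈ range (k + 1), (2 * theta (n + 1) i) • σ i = S at h0 h3 hx ⊢
    generalize ∑ j ∈ range k, (cumWeight n (j + 1) - cumWeight n j) * η j = H at h0 h3 ⊢
    -- now `θ_k²` is expressed by `θ_{k+1}`, and the claim is linear in inner products and values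
    rw [← hθ] at h0 h1 hx ⊢
    simp only [← real_inner_self_eq_norm_sq, inner_add_left,
      inner_add_right, inner_sub_right, inner_sub_left, inner_smul_left, inner_smul_right,
      RCLike.conj_to_real] at h0 h1 h2 h3 h4 hx ⊢
    -- all inner products in one order
    simp only [real_inner_comm (x 0) (φ (k + 1)), real_inner_comm (x 0) (σ (k + 1)),
      real_inner_comm (φ (k + 1)) (σ (k + 1)), real_inner_comm (φ (k + 1)) (φ k),
      real_inner_comm (φ (k + 1)) (σ k),
      real_inner_comm (φ (k + 1)) G, real_inner_comm (φ (k + 1)) S,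
      real_inner_comm (σ (k + 1)) G, real_inner_comm (σ (k + 1)) S, real_inner_comm G S]
      at h0 h1 h2 h3 h4 hx ⊢
    linear_combination h0 + h1 + h2 + h3 + h4 + hx + (η k - η (k + 1)) * hc

/-- The squares `θ_k² ‖σ_k - σ_{k+1}‖²` are dropped; the rest telescopes. -/
lemma subgradEnergy_ge {k : ℕ} (hk : k ≤ n) :
    theta (n + 1) k ^ 2 * ‖σ k‖ ^ 2 + ∑ i ∈ range (k + 1), theta (n + 1) i * ‖σ i‖ ^ 2
      ≤ subgradEnergy n σ k := by
  induction k with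
  | zero => simp [subgradEnergy, theta_zero]; linarith
  | succ k ih =>
    have h0 := ih (by omega)
    have hθ := theta_succ_sq (N := n + 1) (i := k) (by omega)
    have h1 : 0 ≤ theta (n + 1) k ^ 2 * ‖σ k - σ (k + 1)‖ ^ 2 := by positivity
    rw [norm_sub_sq_real] at h1
    rw [sum_range_succ _ (k + 1), subgradEnergy]
    linear_combination h0 + h1 - ‖σ (k + 1)‖ ^ 2 * hθ

/-- Jensen's inequality for the squared norm. -/
lemma norm_sum_smul_sq_le {ι : Type*} {s : Finset ι} {w : ι → ℝ} {v : ι → E}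
    (hw : ∀ i ∈ s, 0 ≤ w i) :
    ‖∑ i ∈ s, w i • v i‖ ^ 2 ≤ (∑ i ∈ s, w i) * ∑ i ∈ s, w i * ‖v i‖ ^ 2 := by
  refine (pow_le_pow_left₀ (norm_nonneg _) (norm_sum_le _ _) 2).trans ?_
  refine sum_sq_le_sum_mul_sum_of_sq_le_mul s hw
    (fun i hi => mul_nonneg (hw i hi) (sq_nonneg _)) fun i hi => le_of_eq ?_
  rw [norm_smul, Real.norm_of_nonneg (hw i hi)]
  ring

/-- Jensen's inequality with the weights that the certificate puts on the subgradient inequalities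
against the minimizer. -/
lemma norm_sq_weighted_subgradients_le (n : ℕ) (σ : ℕ → E) :
    ‖∑ i ∈ range (n + 1), (2 * theta (n + 1) i) • σ i + (theta (n + 1) (n + 1) - 1) • σ n‖ ^ 2
      ≤ (theta (n + 1) (n + 1) ^ 2 - 1) * (∑ i ∈ range (n + 1), 2 * theta (n + 1) i * ‖σ i‖ ^ 2
        + (theta (n + 1) (n + 1) - 1) * ‖σ n‖ ^ 2) := by
  have hq : 0 ≤ theta (n + 1) (n + 1) - 1 := sub_nonneg.2 (one_le_theta _ _)
  have hw : ∀ i, 0 ≤ 2 * theta (n + 1) i := fun i => by linarith [theta_pos (n + 1) i]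
  have h1 := norm_sum_smul_sq_le (s := range (n + 1)) (v := σ)
    (w := fun i => 2 * theta (n + 1) i + if i = n then theta (n + 1) (n + 1) - 1 else 0)
    (fun i _ => add_nonneg (hw i) (by split_ifs <;> [exact hq; exact le_rfl]))
  simp only [add_smul, ite_smul, zero_smul, add_mul, ite_mul, zero_mul, sum_add_distrib,
    sum_ite_eq', mem_range, Nat.lt_succ_self, if_true, sum_two_mul_theta le_rfl] at h1
  rw [← add_mul] at h1
  refine h1.trans (le_of_eq ?_)
  congr 1
  linear_combination -theta_last_sq n

/-- The rate for normalized data.  The inequalities for the last smooth gradient and the surplus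
weight `θ_N - 1` on the last subgradient are added to `potential_le`; then the square of
`x 0 - (ρ Ĝ + Ŝ)` is completed, where `Ĝ` and `Ŝ` are the weighted sums of the smooth gradients and
of the subgradients. -/
theorem normalized_rate (hr : IsNormalizedRun n x y φ σ F η) :
    (theta (n + 1) (n + 1) ^ 2 - 1) * (F (n + 1) + η n) ≤ 1 / 2 * ‖x 0‖ ^ 2 := by
  have h0 := hr.potential_le le_rfl
  have hθ := theta_last_sq n
  have hpos := theta_pos (n + 1) (n + 1)
  have hρ := (ratio_pos n).le
  have hq : 0 ≤ theta (n + 1) (n + 1) - 1 := sub_nonneg.2 (one_le_theta _ _)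
  have hρθ := ratio_mul_theta_sq n
  have h1 := mul_le_mul_of_nonneg_left (hr.smooth_succ n le_rfl)
    (show 0 ≤ 2 * ratio n * theta (n + 1) n ^ 2 by positivity)
  have h2 := mul_le_mul_of_nonneg_left (hr.smooth_zero (n + 1) le_rfl)
    (show 0 ≤ ratio n * theta (n + 1) (n + 1) by positivity)
  have h3 := mul_le_mul_of_nonneg_left (hr.subgradient_step le_rfl) hq
  have hx := congrArg (fun v => ratio n * inner ℝ (φ (n + 1)) v) hr.x_last
  have hE := mul_le_mul_of_nonneg_left (subgradEnergy_ge (σ := σ) (le_refl n)) hρ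
  have hρ1 : 0 ≤ 1 - ratio n := by
    rw [ratio, sub_nonneg, div_le_one (by positivity)]
    linarith
  have hJ := mul_le_mul_of_nonneg_left (norm_sq_weighted_subgradients_le n σ) hρ1
  have hρ2 : (1 - ratio n) * (theta (n + 1) (n + 1) ^ 2 - 1) = ratio n := by
    linear_combination -hρθ
  rw [← mul_assoc, hρ2] at hJ
  have hV : ∑ i ∈ range (n + 1), 2 * theta (n + 1) i * ‖σ i‖ ^ 2
      = 2 * ∑ i ∈ range (n + 1), theta (n + 1) i * ‖σ i‖ ^ 2 := by
    simp only [mul_sum, mul_assoc]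
  rw [hV] at hJ
  have hθ' : theta (n + 1) n ^ 2 = (theta (n + 1) (n + 1) ^ 2 - theta (n + 1) (n + 1)) / 2 := by
    linarith
  simp only [smul_add, sum_add_distrib] at h0 h1 h3 hx
  rw [hθ'] at h0 h1 hx hE
  generalize ∑ i ∈ range (n + 1), theta (n + 1) i * ‖σ i‖ ^ 2 = V at hE hJ
  generalize ∑ i ∈ range (n + 1), (2 * theta (n + 1) i) • φ i = G at h0 h3 hx
  generalize ∑ i ∈ range (n + 1), (2 * theta (n + 1) i) • σ i = S at h0 h3 hx hJ
  generalize ∑ j ∈ range n, (cumWeight n (j + 1) - cumWeight n j) * η j = H at h0 h3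
  have hG : 0 ≤ ratio n * (1 - ratio n) * ‖G + theta (n + 1) (n + 1) • φ (n + 1)‖ ^ 2 := by
    positivity
  have hX : 0 ≤ ‖x 0 - (ratio n • (G + theta (n + 1) (n + 1) • φ (n + 1))
      + (S + (theta (n + 1) (n + 1) - 1) • σ n))‖ ^ 2 := by positivity
  simp only [← real_inner_self_eq_norm_sq, inner_add_left,
    inner_add_right, inner_sub_right, inner_sub_left, inner_smul_left, inner_smul_right,
    RCLike.conj_to_real] at h0 h1 h2 h3 hx hE hJ hG hX ⊢
  -- all inner products in one order
  simp only [real_inner_comm (x 0) (φ (n + 1)), real_inner_comm (x 0) (σ n),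
    real_inner_comm (x 0) G, real_inner_comm (x 0) S,
    real_inner_comm (φ (n + 1)) (σ n), real_inner_comm (φ (n + 1)) (φ n),
    real_inner_comm (φ (n + 1)) G, real_inner_comm (φ (n + 1)) S,
    real_inner_comm (σ n) G, real_inner_comm (σ n) S, real_inner_comm G S]
    at h0 h1 h2 h3 hx hE hJ hG hX ⊢
  linear_combination h0 + h1 + h2 + h3 + hx + hE + hJ / 2 + hG / 2 + hX / 2 - F (n + 1) * hρθ

end IsNormalizedRun

/-! ### Runs of the method -/

section Runs

variable {d : ℕ} {L : ℝ} {f : EuclideanSpace ℝ (Fin d) → ℝ}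
  {h : EuclideanSpace ℝ (Fin d) → EReal} {xs x₀ : EuclideanSpace ℝ (Fin d)} {n : ℕ}
  {x y z : ℕ → EuclideanSpace ℝ (Fin d)}

lemma exists_isRun (hL : 0 < L) (hf : IsSmoothConvex L f) (hh : IsClosedConvexProper h)
    (hxs : IsMinimizer f h xs) (n : ℕ) (x₀ : EuclideanSpace ℝ (Fin d)) :
    ∃ x y z : ℕ → EuclideanSpace ℝ (Fin d), IsRun L f h (n + 1) x₀ x y z := by
  have hprox : ∀ (i : ℕ) (v : EuclideanSpace ℝ (Fin d)),
      ∃ q, i < n + 1 → IsProx (gamma (n + 1) i / L) h v q := by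
    intro i v
    by_cases hi : i < n + 1
    · obtain ⟨q, hq⟩ := exists_isProx (div_pos (gamma_pos (Nat.lt_succ_iff.1 hi)) hL) hh
        (hxs.ne_top hh) (g := -gradient f xs) (fun u hu => by
          have := hxs.subgradient hh (hf.differentiable xs).hasGradientAt hu
          rw [inner_neg_left]
          linarith) v
      exact ⟨q, fun _ => hq⟩
    · exact ⟨0, fun h => absurd h hi⟩
  choose p hp using hprox
  let ynext (i : ℕ) (x y : EuclideanSpace ℝ (Fin d)) : EuclideanSpace ℝ (Fin d) :=
    p i (y - (gamma (n + 1) i / L) • gradient f x)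
  let znext (i : ℕ) (x y : EuclideanSpace ℝ (Fin d)) : EuclideanSpace ℝ (Fin d) :=
    x + (1 / gamma (n + 1) i) • (ynext i x y - y)
  -- the components are `x`, `y`, `z`, in this order
  let run : ℕ → EuclideanSpace ℝ (Fin d) × EuclideanSpace ℝ (Fin d) × EuclideanSpace ℝ (Fin d) :=
    fun k => Nat.rec (x₀, x₀, x₀) (fun i s =>
      (znext i s.1 s.2.1
        + ((theta (n + 1) i - 1) / theta (n + 1) (i + 1)) • (znext i s.1 s.2.1 - s.2.2)
        + (theta (n + 1) i / theta (n + 1) (i + 1)) • (znext i s.1 s.2.1 - s.1),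
        ynext i s.1 s.2.1, znext i s.1 s.2.1)) k
  exact ⟨fun k => (run k).1, fun k => (run k).2.1, fun k => (run k).2.2,
    { x_zero := rfl
      y_zero := rfl
      z_zero := rfl
      y_succ := fun i hi => hp i _ hi
      z_succ := fun i _ => rfl
      x_succ := fun i _ => rfl }⟩

/-- The momentum form of the iteration: `θ_k x_k - (θ_k - 1) z_k` performs gradient steps with
stepsizes `2 θ_i`. -/
lemma IsRun.theta_smul_sub (hr : IsRun L f h (n + 1) x₀ x y z) {k : ℕ} (hk : k ≤ n + 1) :
    theta (n + 1) k • x k - (theta (n + 1) k - 1) • z k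
      = x₀ - ∑ i ∈ range k, (2 * theta (n + 1) i) • (1 / gamma (n + 1) i) • (y i - y (i + 1)) := by
  induction k with
  | zero => simp [theta_zero, hr.x_zero]
  | succ k ih =>
    have h1 := ih (by omega)
    have h2 := hr.z_succ k (by omega)
    have hθ := (theta_pos (n + 1) (k + 1)).ne'
    rw [sum_range_succ, hr.x_succ k (by omega), smul_add, smul_add, smul_smul, smul_smul,
      mul_div_cancel₀ _ hθ, mul_div_cancel₀ _ hθ]
    linear_combination (norm := module) h1 + (2 * theta (n + 1) k) • h2

/-- The subgradient of `h / L` at `y_{k+1}` that the proximal step provides, after moving the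
linear function `⟪∇f(x⋆), ·⟫ / L` to it. -/
lemma IsRun.subgradient (hL : 0 < L) (hh : IsClosedConvexProper h)
    (hr : IsRun L f h (n + 1) x₀ x y z) {k : ℕ} (hk : k ≤ n)
    {u g : EuclideanSpace ℝ (Fin d)} (hu : h u ≠ ⊤) :
    L⁻¹ * ((h (y (k + 1))).toReal - (h u).toReal + inner ℝ g (y (k + 1) - u))
      ≤ inner ℝ ((1 / gamma (n + 1) k) • (y k - y (k + 1)) - L⁻¹ • (gradient f (x k) - g))
        (y (k + 1) - u) := by
  have h1 := mul_le_mul_of_nonneg_left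
    ((hr.y_succ k (Nat.lt_succ_of_le hk)).subgradient hh hu) (inv_pos.2 hL).le
  have hγ := gamma_pos hk
  have e : (gamma (n + 1) k / L)⁻¹ •
        (y k - (gamma (n + 1) k / L) • gradient f (x k) - y (k + 1))
      = L • ((1 / gamma (n + 1) k) • (y k - y (k + 1)) - L⁻¹ • gradient f (x k)) := by
    match_scalars <;> field_simp
  rw [e, ← neg_sub (y (k + 1)) u, inner_neg_right, inner_smul_left, RCLike.conj_to_real,
    inner_sub_left, inner_smul_left _ _ L⁻¹, RCLike.conj_to_real] at h1
  rw [inner_sub_left, inner_smul_left _ _ L⁻¹, RCLike.conj_to_real,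
    inner_sub_left (gradient f (x k))]
  have e2 : ∀ a : ℝ, L⁻¹ * (L * a) = a := fun a => inv_mul_cancel_left₀ hL.ne' a
  rw [mul_add, mul_neg, e2] at h1
  linarith

/-- The interpolation inequality for `f / L` after subtracting a linear function. -/
lemma IsSmoothConvex.normalized_interpolation (hL : 0 < L) (hf : IsSmoothConvex L f)
    (u v g p : EuclideanSpace ℝ (Fin d)) :
    L⁻¹ * (f v - f p - inner ℝ g (v - p)) + inner ℝ (L⁻¹ • (gradient f v - g)) (u - v)
      + 1 / 2 * ‖L⁻¹ • (gradient f u - g) - L⁻¹ • (gradient f v - g)‖ ^ 2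
      ≤ L⁻¹ * (f u - f p - inner ℝ g (u - p)) := by
  have h1 := mul_le_mul_of_nonneg_left (hf.interpolation hL u v) (inv_pos.2 hL).le
  rw [← smul_sub, sub_sub_sub_cancel_right, norm_smul, Real.norm_of_nonneg (inv_pos.2 hL).le,
    inner_smul_left, RCLike.conj_to_real, inner_sub_left]
  have e : inner ℝ g (u - p) = inner ℝ g (u - v) + inner ℝ g (v - p) := by
    rw [← inner_add_right, sub_add_sub_cancel]
  rw [e]
  have e2 : L⁻¹ * (1 / (2 * L) * ‖gradient f u - gradient f v‖ ^ 2)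
      = 1 / 2 * (L⁻¹ * ‖gradient f u - gradient f v‖) ^ 2 := by field_simp
  rw [mul_add, e2] at h1
  linarith

lemma IsRun.isNormalizedRun (hL : 0 < L) (hf : IsSmoothConvex L f) (hh : IsClosedConvexProper h)
    (hxs : IsMinimizer f h xs) (hr : IsRun L f h (n + 1) x₀ x y z) :
    IsNormalizedRun n (fun k => x k - xs) (fun k => y k - xs)
      (fun k => L⁻¹ • (gradient f (x k) - gradient f xs))
      (fun k => (1 / gamma (n + 1) k) • (y k - y (k + 1))
        - L⁻¹ • (gradient f (x k) - gradient f xs))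
      (fun k => L⁻¹ * (f (x k) - f xs - inner ℝ (gradient f xs) (x k - xs)))
      (fun k => L⁻¹ * ((h (y (k + 1))).toReal - (h xs).toReal
        + inner ℝ (gradient f xs) (y (k + 1) - xs))) where
  y_zero := by rw [hr.y_zero, hr.x_zero]
  y_succ k hk := by
    have := (gamma_pos hk).ne'
    rw [add_sub_cancel, smul_smul, mul_one_div_cancel this]
    module
  x_succ k hk := by
    have h1 := hr.theta_smul_sub (k := k + 1) (by omega)
    have h2 := hr.z_succ k (by omega)
    have hθ := theta_succ_sq (N := n + 1) (i := k) (by omega)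
    simp only [add_sub_cancel, hr.x_zero]
    linear_combination (norm := module) theta (n + 1) (k + 1) • h1
      + theta (n + 1) k ^ 2 • h2 + hθ • (z (k + 1) - xs)
  x_last := by
    have h1 := hr.theta_smul_sub le_rfl
    have h2 := hr.z_succ n (by omega)
    have hθ := theta_last_sq n
    simp only [add_sub_cancel, hr.x_zero]
    linear_combination (norm := module) theta (n + 1) (n + 1) • h1
      + (2 * theta (n + 1) n ^ 2) • h2 + hθ • (z (n + 1) - xs)
  smooth_zero k _ := by
    have h1 := hf.normalized_interpolation hL xs (x k) (gradient f xs) xs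
    rw [sub_self (gradient f xs), smul_zero, zero_sub, norm_neg, ← neg_sub (x k) xs,
      inner_neg_right, sub_self, sub_self, inner_zero_right, sub_zero, mul_zero] at h1
    linarith
  smooth_succ k _ := by
    simp only [sub_sub_sub_cancel_right]
    exact hf.normalized_interpolation hL (x k) (x (k + 1)) (gradient f xs) xs
  subgradient_zero k hk := hr.subgradient hL hh hk (hxs.ne_top hh)
  subgradient k hk l hl := by
    have h1 := hr.subgradient hL hh hl (g := gradient f xs)
      ((hr.y_succ k (Nat.lt_succ_of_le hk)).isMinimizer.ne_top hh)
    simp only [sub_sub_sub_cancel_right]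
    have e : inner ℝ (gradient f xs) (y (l + 1) - xs)
        = inner ℝ (gradient f xs) (y (l + 1) - y (k + 1))
          + inner ℝ (gradient f xs) (y (k + 1) - xs) := by
      rw [← inner_add_right, sub_add_sub_cancel]
    rw [e]
    refine le_trans (le_of_eq ?_) h1
    ring

lemma IsRun.value_sub_le (hL : 0 < L) (hf : IsSmoothConvex L f) (hh : IsClosedConvexProper h)
    (hxs : IsMinimizer f h xs) (hr : IsRun L f h (n + 1) x₀ x y z) :
    (f (y (n + 1)) : EReal) + h (y (n + 1)) - (f xs : EReal) - h xs
      ≤ (OptISTA.rate L ‖x₀ - xs‖ (n + 1) : EReal) := by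
  have hn := hr.isNormalizedRun hL hf hh hxs
  have h1 := hn.normalized_rate
  have h2 : x (n + 1) = y (n + 1) := sub_left_injective hn.x_last_eq_y_last
  have hP := theta_last_sq_sub_one_pos n
  have hy := (hr.y_succ n (Nat.lt_succ_self n)).isMinimizer.ne_top hh
  rw [← EReal.coe_toReal hy (hh.ne_bot _), ← EReal.coe_toReal (hxs.ne_top hh) (hh.ne_bot _),
    ← EReal.coe_add, ← EReal.coe_sub, ← EReal.coe_sub, EReal.coe_le_coe_iff, rate,
    le_div_iff₀ (by positivity)]
  simp only [h2, hr.x_zero] at h1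
  have h3 := mul_le_mul_of_nonneg_left h1 hL.le
  have e : ∀ a b : ℝ, L * ((theta (n + 1) (n + 1) ^ 2 - 1) * (L⁻¹ * a + L⁻¹ * b))
      = (theta (n + 1) (n + 1) ^ 2 - 1) * (a + b) := fun a b => by field_simp
  rw [e] at h3
  linarith

end Runs

end OptISTA

end

theorem theorem1 {d : ℕ} (L : ℝ) (hL : 0 < L)
    (f : EuclideanSpace ℝ (Fin d) → ℝ) (hf : OptISTA.IsSmoothConvex L f)
    (h : EuclideanSpace ℝ (Fin d) → EReal) (hh : OptISTA.IsClosedConvexProper h)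
    (xs : EuclideanSpace ℝ (Fin d)) (hxs : OptISTA.IsMinimizer f h xs) :
    -- for every iteration count and starting point, OptISTA is well defined and has the rate
    (∀ N : ℕ, 0 < N → ∀ x₀ : EuclideanSpace ℝ (Fin d),
      (∀ i < N, 0 < OptISTA.gamma N i) ∧
      (∃ x y z : ℕ → EuclideanSpace ℝ (Fin d), OptISTA.IsRun L f h N x₀ x y z) ∧
      (∀ x y z : ℕ → EuclideanSpace ℝ (Fin d), OptISTA.IsRun L f h N x₀ x y z →
        (f (y N) : EReal) + h (y N) - (f xs : EReal) - h xs
          ≤ (OptISTA.rate L ‖x₀ - xs‖ N : EReal)) ∧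
      OptISTA.rate L ‖x₀ - xs‖ N ≤ L * ‖x₀ - xs‖ ^ 2 / ((N : ℝ) + 1) ^ 2) ∧
    -- the bound is asymptotically better than that of FISTA by a factor of 2
    (∀ R : ℝ, 0 < R →
      Filter.Tendsto (fun N : ℕ => OptISTA.fistaRate L R N / OptISTA.rate L R N)
        Filter.atTop (nhds 2)) := by
  refine ⟨fun N hN x₀ => ?_, fun R hR => OptISTA.tendsto_fistaRate_div_rate hL hR⟩
  obtain ⟨n, rfl⟩ := Nat.exists_eq_succ_of_ne_zero hN.ne'
  exact ⟨fun i hi => OptISTA.gamma_pos (Nat.lt_succ_iff.1 hi),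
    OptISTA.exists_isRun hL hf hh hxs n x₀,
    fun x y z hr => hr.value_sub_le hL hf hh hxs,
    OptISTA.rate_le hL _ n⟩
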